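/- Let $\mathbb{C}^+=\{z\in\mathbb{C}:\operatorname{Re} z>0\}$ and let $\varphi\in H^\infty(\mathbb{C}^+)$, i.e. $\varphi$ is a bounded analytic function on $\mathbb{C}^+$. Then $\varphi$ has a nontangential limit $\varphi(iy)$ at $iy$ for almost every $y\in\mathbb{R}$, and the boundary function $y\mapsto\varphi(iy)$ belongs to $L^\infty(\mathbb{R})$. A topologically invariant mean is a continuous linear functional $\Phi$ on the complex space $L^\infty(\mathbb{R})$ such that $\Phi(\psi)\ge 0$ whenever $\psi\ge 0$, $\Phi(1)=1$, and $\Phi(f*\psi)=\Phi(\psi)$ for all $\psi\in L^\infty(\mathbb{R})$ and all $f\in L^1(\mathbb{R})$ with $f\ge 0$ and $\int_{\mathbb{R}} f(x)\,dx=1$, where $(f*\psi)(x)=\int_{\mathbb{R}}\psi(x-t)f(t)\,dt$. A function $\psi\in L^\infty(\mathbb{R})$ is almost convergent to $\alpha\in\mathbb{C}$ if $\Phi(\psi)=\alpha$ for every topologically invariant mean $\Phi$. For every $\alpha\in\mathbb{C}$ the following are equivalent: 1. the boundary function $y\mapsto\varphi(iy)$ is almost convergent to $\alpha$; 2. $\displaystyle\lim_{\theta\to\infty}\frac{1}{2\theta}\int_{y-\theta}^{y+\theta}\varphi(it)\,dt=\alpha$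 uniformly in $y\in\mathbb{R}$; 3. $\displaystyle\lim_{x\to\infty}\varphi(x+iy)=\alpha$ uniformly in $y\in\mathbb{R}$. -/

import Mathlib

open MeasureTheory Filter Topology
open scoped ENNReal ComplexOrder Convolution

namespace AlmostConvergence

/-- The Banach space `L^∞(ℝ)` of (classes of) complex-valued essentially bounded functions. -/
abbrev LInfty : Type := Lp ℂ ∞ (volume : Measure ℝ)

/-- The constant function `1` as an element of `L^∞(ℝ)`. -/
noncomputable def oneLInfty : LInfty :=
  (memLp_top_const (1 : ℂ) : MemLp (fun _ : ℝ => (1 : ℂ)) ∞ volume).toLp _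

/-- `f ∈ P(ℝ)`: `f ∈ L¹(ℝ)`, `f ≥ 0` and `∫ f = 1`. -/
structure IsDensity (f : ℝ → ℝ) : Prop where
  integrable : Integrable f
  nonneg : 0 ≤ᵐ[volume] f
  integral_eq_one : ∫ t, f t = 1

/-- The convolution `(f * ψ)(x) = ∫ f(t) ψ(x - t) dt` of an `L¹` and an `L^∞` function. -/
noncomputable def conv (f : ℝ → ℝ) (ψ : ℝ → ℂ) : ℝ → ℂ :=
  f ⋆[ContinuousLinearMap.lsmul ℝ ℝ, volume] ψ

theorem memLp_conv {f : ℝ → ℝ} (hf : Integrable f) (ψ : LInfty) :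
    MemLp (conv f ψ) ∞ volume := by
  have hψ := Lp.aestronglyMeasurable ψ
  refine memLp_top_of_bound (C := ∫ t, ‖f t‖ * ‖ψ‖) ?_ ?_
  · exact (hf.aestronglyMeasurable.convolution_integrand
      (ContinuousLinearMap.lsmul ℝ ℝ) hψ).integral_prod_right'
  · refine Eventually.of_forall fun x => ?_
    have hb : ∀ᵐ t : ℝ, ‖ψ t‖ ≤ ‖ψ‖ := by
      have := ae_le_eLpNormEssSup (f := (ψ : ℝ → ℂ)) (μ := volume)
      filter_upwards [this] with t ht
      rw [Lp.norm_def, eLpNorm_exponent_top, ← toReal_enorm]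
      refine ENNReal.toReal_mono ?_ ht
      rw [← eLpNorm_exponent_top]
      exact Lp.eLpNorm_ne_top ψ
    have hb' : ∀ᵐ t : ℝ, ‖ψ (x - t)‖ ≤ ‖ψ‖ :=
      (Measure.measurePreserving_sub_left volume x).quasiMeasurePreserving.ae hb
    refine norm_integral_le_of_norm_le (hf.norm.mul_const _) ?_
    filter_upwards [hb'] with t ht
    simp only [ContinuousLinearMap.lsmul_apply, norm_smul]
    gcongr

/-- A mean on `L^∞(ℝ)`: a positive continuous linear functional with `Φ 1 = 1`. -/
structure IsMean (Φ : StrongDual ℂ LInfty) : Prop where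
  nonneg : ∀ ψ : LInfty, (∀ᵐ x : ℝ, 0 ≤ ψ x) → 0 ≤ Φ ψ
  map_one : Φ oneLInfty = 1

/-- A topologically invariant mean: `Φ (f * ψ) = Φ ψ` for `f ∈ P(ℝ)` and `ψ ∈ L^∞(ℝ)`. -/
structure IsTopologicallyInvariantMean (Φ : StrongDual ℂ LInfty) : Prop extends IsMean Φ where
  map_conv : ∀ (f : ℝ → ℝ) (hf : IsDensity f) (ψ : LInfty),
    Φ ((memLp_conv hf.integrable ψ).toLp (conv f ψ)) = Φ ψ

/-- `ψ ∈ L^∞(ℝ)` is almost convergent to `α`. -/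
def AlmostConvergent (ψ : LInfty) (α : ℂ) : Prop :=
  ∀ Φ : StrongDual ℂ LInfty, IsTopologicallyInvariantMean Φ → Φ ψ = α

/-- The open right half plane. -/
def rightHalfPlane : Set ℂ := {z | 0 < z.re}

/-- `φ ∈ H^∞(ℂ⁺)`. The values of `φ` outside the open right half plane play no role. -/
structure MemHInfty (φ : ℂ → ℂ) : Prop where
  analytic : DifferentiableOn ℂ φ rightHalfPlane
  bounded : ∃ C : ℝ, ∀ z ∈ rightHalfPlane, ‖φ z‖ ≤ C

/-- The cone of aperture `M` in the open right half plane with vertex `i y`. -/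
def stolzCone (y M : ℝ) : Set ℂ := {z | 0 < z.re ∧ |z.im - y| ≤ M * z.re}

/-- Nontangential approach to `i y`: convergence along this filter is convergence to `i y`
inside each cone `stolzCone y M`. -/
noncomputable def nontangential (y : ℝ) : Filter ℂ :=
  ⨆ M : ℝ, 𝓝[stolzCone y M] (Complex.I * y)

/-- The boundary function `y ↦ φ(iy)` given by the nontangential limits of `φ` (with an
unspecified value at the points where there is no such limit). -/
noncomputable def boundaryFunction (φ : ℂ → ℂ) (y : ℝ) : ℂ :=
  limUnder (nontangential y) φ

end AlmostConvergence

/-!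
A topologically invariant mean is unchanged by convolution with a density and is norm continuous,
so uniform convergence of `K_x * ψ` to `α`, for the dilates `K_x` of a density `K`, determines its
value at `ψ`. Conversely, the translates of `K_x` are asymptotically equal in `L¹` as `x → ∞`, so
every weak-* limit of the functionals `ψ ↦ (K_x * ψ)(y)` is a topologically invariant mean; if
`(K_x * ψ)(y)` failed to tend to `α` uniformly in `y`, one of these means would miss `α` at `ψ`.
The uniform density on `[-1, 1]` turns this into the symmetric averages, and the Cauchy density
into the Poisson integral, which recovers `φ (x + iy)`.

Under the Cayley transform the Poisson formula is the mean value property on hyperbolic circles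
growing to the boundary. It also gives Fatou's theorem: a primitive `F` of `φ` is Lipschitz, so
`t ↦ F (it)` is differentiable almost everywhere; at such a point `iy` the difference quotient of
`F` is the Poisson integral of a bounded function continuous at `y`, so `F` has a derivative at `iy`
from within the half plane, and the Cauchy estimate in the cones carries this over to the
derivative `φ` of `F`.
-/

namespace AlmostConvergence

open ProbabilityTheory (cauchyPDFReal integrable_cauchyPDFReal)

section Convolution

variable {f k : ℝ → ℝ} {ψ ψ' : ℝ → ℂ}

theorem conv_apply (f : ℝ → ℝ) (ψ : ℝ → ℂ) (y : ℝ) : conv f ψ y = ∫ t, f t • ψ (y - t) := rfl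

theorem conv_apply_swap (f : ℝ → ℝ) (ψ : ℝ → ℂ) (y : ℝ) :
    conv f ψ y = ∫ t, f (y - t) • ψ t := by
  rw [conv_apply, ← integral_sub_left_eq_self _ volume y]
  simp only [sub_sub_cancel]

theorem conv_congr_right (f : ℝ → ℝ) (h : ψ =ᵐ[volume] ψ') : conv f ψ = conv f ψ' :=
  convolution_congr _ (ae_eq_refl f) h

theorem integrable_smul_comp_sub_left (hf : Integrable f) (hψ : MemLp ψ ∞ volume) (y : ℝ) :
    Integrable fun t => f t • ψ (y - t) :=
  hf.smul_of_top_left (hψ.comp_measurePreserving (Measure.measurePreserving_sub_left volume y))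

theorem norm_conv_le (hf : Integrable f) (hψ : MemLp ψ ∞ volume) (y : ℝ) :
    ‖conv f ψ y‖ ≤ (∫ t, ‖f t‖) * lpNorm ψ ∞ volume := by
  rw [conv_apply, ← integral_mul_const]
  refine norm_integral_le_of_norm_le (hf.norm.mul_const _) ?_
  filter_upwards [(Measure.measurePreserving_sub_left volume y).quasiMeasurePreserving.ae
    (ae_le_lpNorm_exponent_top hψ)] with t ht
  rw [norm_smul]
  gcongr

theorem conv_conv_comm (hf : Integrable f) (hk : Integrable k) (hψ : MemLp ψ ∞ volume) (y : ℝ) :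
    conv k (conv f ψ) y = conv f (conv k ψ) y := by
  have hint : Integrable (fun p : ℝ × ℝ => k p.1 • f p.2 • ψ (y - p.1 - p.2))
      (volume.prod volume) := by
    have hq : Measure.QuasiMeasurePreserving (fun p : ℝ × ℝ => y - p.1 - p.2)
        (volume.prod volume) volume :=
      (quasiMeasurePreserving_sub volume volume).comp
        ((Measure.measurePreserving_sub_left volume y).prod
          (MeasurePreserving.id volume)).quasiMeasurePreserving
    refine ((hk.mul_prod hf).smul_bdd (lpNorm ψ ∞ volume)
      (hψ.aestronglyMeasurable.comp_quasiMeasurePreserving hq)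
      (hq.ae (ae_le_lpNorm_exponent_top hψ))).congr (ae_of_all _ fun p => ?_)
    exact mul_smul (k p.1) (f p.2) _
  calc conv k (conv f ψ) y = ∫ s, ∫ t, k s • f t • ψ (y - s - t) := by
        simp only [conv_apply, integral_smul]
    _ = ∫ t, ∫ s, k s • f t • ψ (y - s - t) := integral_integral_swap hint
    _ = conv f (conv k ψ) y := by
        simp only [conv_apply, ← integral_smul]
        refine integral_congr_ae (ae_of_all _ fun t => integral_congr_ae (ae_of_all _ fun s => ?_))
        simp only [smul_comm (k s), sub_right_comm y s]

/-- The functional `ψ ↦ (f * ψ)(y)` on `L^∞(ℝ)`. -/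
noncomputable def convEval (hf : Integrable f) (y : ℝ) : StrongDual ℂ LInfty :=
  LinearMap.mkContinuous
    { toFun := fun ψ => conv f ψ y
      map_add' := fun ψ χ => by
        rw [conv_congr_right f (Lp.coeFn_add ψ χ)]
        simp only [conv_apply, Pi.add_apply, smul_add]
        exact integral_add (integrable_smul_comp_sub_left hf (Lp.memLp ψ) y)
          (integrable_smul_comp_sub_left hf (Lp.memLp χ) y)
      map_smul' := fun c ψ => by
        rw [conv_congr_right f (Lp.coeFn_smul c ψ)]
        simp only [conv_apply, Pi.smul_apply, smul_comm _ c, integral_smul, RingHom.id_apply] }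
    (∫ t, ‖f t‖) fun ψ => by
      simpa only [LinearMap.coe_mk, AddHom.coe_mk, Lp.norm_def,
        toReal_eLpNorm (Lp.aestronglyMeasurable ψ)] using norm_conv_le hf (Lp.memLp ψ) y

theorem norm_convEval_le (hf : Integrable f) (y : ℝ) : ‖convEval hf y‖ ≤ ∫ t, ‖f t‖ :=
  LinearMap.mkContinuous_norm_le _ (integral_nonneg fun _ => norm_nonneg _) _

theorem conv_nonneg (hf : 0 ≤ᵐ[volume] f) (hψ : ∀ᵐ x : ℝ, 0 ≤ ψ x) (y : ℝ) :
    0 ≤ conv f ψ y := by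
  rw [conv_apply]
  refine integral_nonneg_of_ae ?_
  filter_upwards [hf, (Measure.measurePreserving_sub_left volume y).quasiMeasurePreserving.ae hψ]
    with t hft hψt
  exact smul_nonneg hft hψt

theorem coeFn_oneLInfty : (oneLInfty : ℝ → ℂ) =ᵐ[volume] fun _ => 1 :=
  MemLp.coeFn_toLp _

theorem IsDensity.conv_oneLInfty (hf : IsDensity f) (y : ℝ) : conv f oneLInfty y = 1 := by
  rw [conv_congr_right f coeFn_oneLInfty, conv_apply, integral_smul_const, hf.integral_eq_one,
    one_smul]

theorem IsDensity.integral_norm (hf : IsDensity f) : ∫ t, ‖f t‖ = 1 := by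
  rw [← hf.integral_eq_one]
  refine integral_congr_ae ?_
  filter_upwards [hf.nonneg] with t ht
  exact Real.norm_of_nonneg ht

end Convolution

section TranslationModulus

variable {f k : ℝ → ℝ} {ψ : ℝ → ℂ}

/-- The `L¹` modulus of continuity `‖k(· - s) - k‖₁` of `k` under translation by `s`. -/
noncomputable def translationModulus (k : ℝ → ℝ) (s : ℝ) : ℝ := ∫ u, ‖k (u - s) - k u‖

theorem translationModulus_zero (k : ℝ → ℝ) : translationModulus k 0 = 0 := by
  simp [translationModulus]

theorem translationModulus_nonneg (k : ℝ → ℝ) (s : ℝ) : 0 ≤ translationModulus k s :=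
  integral_nonneg fun _ => norm_nonneg _

theorem translationModulus_le (hk : Integrable k) (s : ℝ) :
    translationModulus k s ≤ 2 * ∫ u, ‖k u‖ := by
  calc translationModulus k s ≤ ∫ u, (‖k (u - s)‖ + ‖k u‖) :=
        integral_mono ((hk.comp_sub_right s).sub hk).norm ((hk.comp_sub_right s).norm.add hk.norm)
          fun u => norm_sub_le _ _
    _ = 2 * ∫ u, ‖k u‖ := by
        rw [integral_add (hk.comp_sub_right s).norm hk.norm,
          integral_sub_right_eq_self (fun u => ‖k u‖), two_mul]

theorem continuous_translationModulus (hk : Integrable k) :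
    Continuous (translationModulus k) := by
  have : Fact ((1 : ℝ≥0∞) ≠ ∞) := ⟨ENNReal.one_ne_top⟩
  have hm : MemLp k 1 volume := memLp_one_iff_integrable.2 hk
  have hcont : Continuous fun s : ℝ => (DomAddAct.mk (-s) +ᵥ hm.toLp k) - hm.toLp k :=
    ((DomAddAct.continuous_mk.comp continuous_neg).vadd continuous_const).sub continuous_const
  refine hcont.norm.congr fun s => ?_
  rw [L1.norm_eq_integral_norm, translationModulus]
  refine integral_congr_ae ?_
  rw [DomAddAct.mk_vadd_toLp, ← MemLp.toLp_sub]
  filter_upwards [MemLp.coeFn_toLp ((hm.comp_measurePreserving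
    (measurePreserving_vadd (-s) volume)).sub hm)] with u hu
  refine (congrArg norm hu).trans ?_
  simp only [Pi.sub_apply, Function.comp_apply, vadd_eq_add, neg_add_eq_sub]

theorem norm_conv_sub_sub_conv_le (hk : Integrable k) (hψ : MemLp ψ ∞ volume) (y s : ℝ) :
    ‖conv k ψ (y - s) - conv k ψ y‖ ≤ translationModulus k s * lpNorm ψ ∞ volume := by
  have hsmul (x : ℝ) : Integrable fun t => k (x - t) • ψ t :=
    (hk.comp_sub_left x).smul_of_top_left hψ
  have hmod : translationModulus k s = ∫ t, ‖k (y - s - t) - k (y - t)‖ := by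
    rw [translationModulus, ← integral_sub_left_eq_self _ volume y]
    simp only [sub_right_comm]
  rw [conv_apply_swap, conv_apply_swap, ← integral_sub (hsmul _) (hsmul _), hmod,
    ← integral_mul_const]
  refine norm_integral_le_of_norm_le
    (((hk.comp_sub_left (y - s)).sub (hk.comp_sub_left y)).norm.mul_const _) ?_
  filter_upwards [ae_le_lpNorm_exponent_top hψ] with t ht
  rw [← sub_smul, norm_smul]
  gcongr

theorem continuous_conv (hk : Integrable k) (hψ : MemLp ψ ∞ volume) : Continuous (conv k ψ) := by
  refine continuous_iff_continuousAt.2 fun y => tendsto_iff_norm_sub_tendsto_zero.2 ?_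
  have hmod : Tendsto (fun z => translationModulus k (y - z) * lpNorm ψ ∞ volume) (𝓝 y) (𝓝 0) := by
    have hcont : Continuous fun z => translationModulus k (y - z) * lpNorm ψ ∞ volume := by
      have := continuous_translationModulus hk
      fun_prop
    simpa only [sub_self, translationModulus_zero, zero_mul] using hcont.tendsto y
  refine squeeze_zero (fun _ => norm_nonneg _) (fun z => ?_) hmod
  simpa only [sub_sub_cancel] using norm_conv_sub_sub_conv_le hk hψ y (y - z)

theorem IsDensity.norm_conv_conv_sub_conv_le (hf : IsDensity f) (hk : Integrable k)
    (hψ : MemLp ψ ∞ volume) (y : ℝ) :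
    ‖conv k (conv f ψ) y - conv k ψ y‖ ≤
      (∫ s, f s * translationModulus k s) * lpNorm ψ ∞ volume := by
  have hconv : MemLp (conv k ψ) ∞ volume :=
    memLp_top_of_bound (continuous_conv hk hψ).aestronglyMeasurable _
      (ae_of_all _ (norm_conv_le hk hψ))
  have havg : conv k ψ y = ∫ s, f s • conv k ψ y := by
    rw [integral_smul_const, hf.integral_eq_one, one_smul]
  have hmod : Integrable fun s => f s * translationModulus k s :=
    hf.integrable.mul_bdd (c := 2 * ∫ u, ‖k u‖)
      (continuous_translationModulus hk).aestronglyMeasurable (ae_of_all _ fun s => by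
        rw [Real.norm_of_nonneg (translationModulus_nonneg k s)]
        exact translationModulus_le hk s)
  rw [conv_conv_comm hf.integrable hk hψ, conv_apply f, havg,
    ← integral_sub (integrable_smul_comp_sub_left hf.integrable hconv y)
      (hf.integrable.smul_const _), ← integral_mul_const]
  refine norm_integral_le_of_norm_le (hmod.mul_const _) ?_
  filter_upwards [hf.nonneg] with s hs
  rw [← smul_sub, norm_smul, Real.norm_of_nonneg hs, mul_assoc]
  exact mul_le_mul_of_nonneg_left (norm_conv_sub_sub_conv_le hk hψ y s) hs

end TranslationModulus

section AlmostConvergent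

variable {ι : Type*} {k : ι → ℝ → ℝ} {l : Filter ι}

/-- A family of kernels is asymptotically translation invariant in `L¹` along `l`. -/
def AsymptoticallyInvariant (k : ι → ℝ → ℝ) (l : Filter ι) : Prop :=
  ∀ s, Tendsto (fun i => translationModulus (k i) s) l (𝓝 0)

theorem AsymptoticallyInvariant.tendsto_integral [l.IsCountablyGenerated]
    (h : AsymptoticallyInvariant k l) (hk : ∀ i, IsDensity (k i)) {f : ℝ → ℝ}
    (hf : Integrable f) :
    Tendsto (fun i => ∫ s, f s * translationModulus (k i) s) l (𝓝 0) := by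
  rw [← integral_zero ℝ ℝ (μ := volume)]
  refine tendsto_integral_filter_of_dominated_convergence (fun s => ‖f s‖ * 2)
    (.of_forall fun i => hf.aestronglyMeasurable.mul
      (continuous_translationModulus (hk i).integrable).aestronglyMeasurable)
    (.of_forall fun i => ae_of_all _ fun s => ?_) (hf.norm.mul_const 2)
    (ae_of_all _ fun s => by simpa only [mul_zero] using (h s).const_mul (f s))
  rw [norm_mul, Real.norm_of_nonneg (translationModulus_nonneg (k i) s)]
  gcongr
  simpa only [(hk i).integral_norm, mul_one] using translationModulus_le (hk i).integrable s

theorem AsymptoticallyInvariant.tendsto_conv_conv_sub_conv [l.IsCountablyGenerated]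
    (h : AsymptoticallyInvariant k l) (hk : ∀ i, IsDensity (k i)) {f : ℝ → ℝ}
    (hf : IsDensity f) {ψ : ℝ → ℂ} (hψ : MemLp ψ ∞ volume) :
    Tendsto (fun p : ι × ℝ => conv (k p.1) (conv f ψ) p.2 - conv (k p.1) ψ p.2) (l ×ˢ ⊤)
      (𝓝 0) := by
  have hbound := ((h.tendsto_integral hk hf.integrable).comp
    (tendsto_fst (g := (⊤ : Filter ℝ)))).mul_const (lpNorm ψ ∞ volume)
  rw [zero_mul] at hbound
  exact squeeze_zero_norm
    (fun p => hf.norm_conv_conv_sub_conv_le (hk p.1).integrable hψ p.2) hbound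

/-- The means are weak-* limits of the functionals `ψ ↦ (kᵢ * ψ)(y)`. -/
theorem AsymptoticallyInvariant.exists_isTopologicallyInvariantMean [l.IsCountablyGenerated]
    (h : AsymptoticallyInvariant k l) (hk : ∀ i, IsDensity (k i)) (U : Ultrafilter (ι × ℝ))
    (hU : (U : Filter (ι × ℝ)) ≤ l ×ˢ ⊤) :
    ∃ Φ : StrongDual ℂ LInfty, IsTopologicallyInvariantMean Φ ∧
      ∀ ψ : LInfty, Tendsto (fun p : ι × ℝ => conv (k p.1) ψ p.2) U (𝓝 (Φ ψ)) := by
  let T : ι × ℝ → WeakDual ℂ LInfty := fun p =>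
    StrongDual.toWeakDual (convEval (hk p.1).integrable p.2)
  have hT (p : ι × ℝ) :
      T p ∈ WeakDual.toStrongDual ⁻¹' Metric.closedBall (0 : StrongDual ℂ LInfty) 1 :=
    mem_closedBall_zero_iff.2 <|
      (norm_convEval_le (hk p.1).integrable p.2).trans_eq (hk p.1).integral_norm
  obtain ⟨Λ, -, hΛ⟩ := (WeakDual.isCompact_closedBall _ _).ultrafilter_le_nhds' (U.map T)
    (Ultrafilter.mem_map.2 (univ_mem' hT))
  have hlim (ψ : LInfty) : Tendsto (fun p : ι × ℝ => conv (k p.1) ψ p.2) U (𝓝 (Λ ψ)) :=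
    ((WeakDual.eval_continuous ψ).tendsto Λ).comp (f := T) hΛ
  refine ⟨WeakDual.toStrongDual Λ, ⟨⟨fun ψ hψ => ?_, ?_⟩, fun f hf ψ => ?_⟩, hlim⟩
  · exact ge_of_tendsto' (hlim ψ) fun p => conv_nonneg (hk p.1).nonneg hψ p.2
  · exact tendsto_nhds_unique (hlim oneLInfty)
      (tendsto_const_nhds.congr fun p => ((hk p.1).conv_oneLInfty p.2).symm)
  · refine eq_of_sub_eq_zero (tendsto_nhds_unique ((hlim _).sub (hlim ψ)) ?_)
    simp only [conv_congr_right _ (memLp_conv hf.integrable ψ).coeFn_toLp]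
    exact (h.tendsto_conv_conv_sub_conv hk hf (Lp.memLp ψ)).mono_left hU

theorem AlmostConvergent.tendstoUniformly_conv [l.IsCountablyGenerated] {ψ : LInfty} {α : ℂ}
    (hψ : AlmostConvergent ψ α) (h : AsymptoticallyInvariant k l) (hk : ∀ i, IsDensity (k i)) :
    TendstoUniformly (fun i => conv (k i) ψ) (fun _ => α) l := by
  rw [← tendsto_prod_top_iff, tendsto_iff_ultrafilter]
  intro U hU
  obtain ⟨Φ, hΦ, hlim⟩ := h.exists_isTopologicallyInvariantMean hk U hU
  rw [← hψ Φ hΦ]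
  exact hlim ψ

theorem tendsto_toLp_top_of_tendstoUniformly {X E : Type*} [MeasurableSpace X] {μ : Measure X}
    [NormedAddCommGroup E] {F : ι → X → E} {g : X → E} (hF : ∀ i, MemLp (F i) ∞ μ)
    (hg : MemLp g ∞ μ) (h : TendstoUniformly F g l) :
    Tendsto (fun i => (hF i).toLp (F i)) l (𝓝 (hg.toLp g)) := by
  rw [Lp.tendsto_Lp_iff_tendsto_eLpNorm'', ENNReal.tendsto_nhds_zero]
  intro ε hε
  obtain ⟨δ, -, hδ, hδε⟩ := ENNReal.lt_iff_exists_real_btwn.1 hε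
  filter_upwards [Metric.tendstoUniformly_iff.1 h δ (ENNReal.ofReal_pos.1 hδ)] with i hi
  rw [eLpNorm_exponent_top]
  refine (eLpNormEssSup_le_of_ae_bound (C := δ) (ae_of_all _ fun x => ?_)).trans hδε.le
  rw [Pi.sub_apply, ← dist_eq_norm, dist_comm]
  exact (hi x).le

theorem almostConvergent_of_tendstoUniformly_conv [l.NeBot] {ψ : LInfty} {α : ℂ}
    (hk : ∀ i, IsDensity (k i)) (h : TendstoUniformly (fun i => conv (k i) ψ) (fun _ => α) l) :
    AlmostConvergent ψ α := by
  intro Φ hΦ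
  have hα : (memLp_top_const α).toLp (fun _ : ℝ => α) = α • oneLInfty := by
    simp only [oneLInfty, ← MemLp.toLp_const_smul]
    congr 1 with x
    simp
  have hlim := (Φ.continuous.tendsto _).comp (tendsto_toLp_top_of_tendstoUniformly
    (fun i => memLp_conv (hk i).integrable ψ) (memLp_top_const α) h)
  rw [hα, map_smul, hΦ.map_one, smul_eq_mul, mul_one] at hlim
  exact tendsto_nhds_unique
    (tendsto_const_nhds.congr fun i => (hΦ.map_conv _ (hk i) ψ).symm) hlim

end AlmostConvergent

section Dilation

variable {K : ℝ → ℝ} {x : ℝ}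

/-- The dilate `t ↦ x⁻¹ K(t / x)` of a kernel, normalised to preserve the integral for `x > 0`. -/
noncomputable def dilate (K : ℝ → ℝ) (x t : ℝ) : ℝ := x⁻¹ * K (t / x)

theorem integral_dilate_smul {E : Type*} [NormedAddCommGroup E] [NormedSpace ℝ E] (K : ℝ → ℝ)
    (hx : 0 < x) (g : ℝ → E) : ∫ t, dilate K x t • g t = ∫ u, K u • g (x * u) := by
  have hscale := Measure.integral_comp_div (fun u => K u • g (x * u)) x
  simp only [mul_div_cancel₀ _ hx.ne', abs_of_pos hx] at hscale
  simp only [dilate, mul_smul, integral_smul, hscale, inv_smul_smul₀ hx.ne']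

theorem conv_dilate (K : ℝ → ℝ) (hx : 0 < x) (ψ : ℝ → ℂ) (y : ℝ) :
    conv (dilate K x) ψ y = ∫ u, K u • ψ (y - x * u) :=
  integral_dilate_smul K hx fun t => ψ (y - t)

theorem IsDensity.dilate (hK : IsDensity K) (hx : 0 < x) : IsDensity (dilate K x) where
  integrable := (hK.integrable.comp_div hx.ne').const_mul _
  nonneg := by
    filter_upwards [(Measure.quasiMeasurePreserving_smul volume (inv_ne_zero hx.ne')).ae hK.nonneg]
      with t ht
    rw [smul_eq_mul, inv_mul_eq_div] at ht
    exact mul_nonneg (inv_nonneg.2 hx.le) ht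
  integral_eq_one := by
    simpa only [smul_eq_mul, mul_one, hK.integral_eq_one] using
      integral_dilate_smul K hx fun _ => (1 : ℝ)

theorem translationModulus_dilate (K : ℝ → ℝ) (hx : 0 < x) (s : ℝ) :
    translationModulus (dilate K x) s = translationModulus K (s / x) := by
  have hscale := Measure.integral_comp_div (fun u => ‖K (u - s / x) - K u‖) x
  simp only [← sub_div, abs_of_pos hx, smul_eq_mul] at hscale
  simp only [translationModulus, dilate, ← mul_sub, norm_mul, integral_const_mul, hscale,
    Real.norm_of_nonneg (inv_nonneg.2 hx.le), inv_mul_cancel_left₀ hx.ne']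

theorem asymptoticallyInvariant_dilate (hK : Integrable K) :
    AsymptoticallyInvariant (fun x : Set.Ioi (0 : ℝ) => dilate K x) atTop := by
  intro s
  simp only [fun x : Set.Ioi (0 : ℝ) => translationModulus_dilate K x.2 s]
  have hdiv : Tendsto (fun x : Set.Ioi (0 : ℝ) => s / (x : ℝ)) atTop (𝓝 0) :=
    tendsto_const_nhds.div_atTop (tendsto_comp_val_Ioi_atTop.2 tendsto_id)
  have hmod := ((continuous_translationModulus hK).tendsto 0).comp hdiv
  rwa [translationModulus_zero] at hmod

theorem IsDensity.almostConvergent_toLp_iff (hK : IsDensity K) {b : ℝ → ℂ}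
    (hb : MemLp b ∞ volume) (α : ℂ) :
    AlmostConvergent (hb.toLp b) α ↔
      TendstoUniformly (fun x y => ∫ u, K u • b (y - x * u)) (fun _ => α) atTop := by
  have hconv (x : Set.Ioi (0 : ℝ)) :
      conv (AlmostConvergence.dilate K x) (hb.toLp b) = fun y => ∫ u, K u • b (y - x * u) := by
    ext y
    rw [conv_congr_right _ hb.coeFn_toLp, conv_dilate K x.2]
  have hdilate (x : Set.Ioi (0 : ℝ)) := hK.dilate x.2
  calc AlmostConvergent (hb.toLp b) α
      ↔ TendstoUniformly (fun x : Set.Ioi (0 : ℝ) => conv (AlmostConvergence.dilate K x)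
          (hb.toLp b)) (fun _ => α) atTop :=
        ⟨fun h => h.tendstoUniformly_conv (asymptoticallyInvariant_dilate hK.integrable) hdilate,
          almostConvergent_of_tendstoUniformly_conv hdilate⟩
    _ ↔ _ := by
        simp only [hconv, Metric.tendstoUniformly_iff]
        refine forall₂_congr fun ε _ => ?_
        rw [← map_val_Ioi_atTop (0 : ℝ), eventually_map]

end Dilation

section UniformAverage

/-- The uniform density on `[-1, 1]`. -/
noncomputable def boxKernel : ℝ → ℝ := (Set.Ioc (-1 : ℝ) 1).indicator fun _ => 1 / 2

theorem integral_boxKernel_smul {E : Type*} [NormedAddCommGroup E] [NormedSpace ℝ E] (g : ℝ → E) :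
    ∫ u, boxKernel u • g u = (1 / 2 : ℝ) • ∫ u in (-1)..1, g u := by
  simp only [boxKernel, ← Set.indicator_smul_apply_left]
  rw [integral_indicator measurableSet_Ioc, integral_smul,
    intervalIntegral.integral_of_le (by norm_num)]

theorem isDensity_boxKernel : IsDensity boxKernel where
  integrable := (integrable_indicator_iff measurableSet_Ioc).2
    (integrableOn_const measure_Ioc_lt_top.ne)
  nonneg := ae_of_all _ fun u => Set.indicator_nonneg (fun _ _ => by norm_num) u
  integral_eq_one := by
    simpa [one_add_one_eq_two] using integral_boxKernel_smul fun _ => (1 : ℝ)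

theorem integral_boxKernel_smul_comp_sub_mul (g : ℝ → ℂ) {x : ℝ} (hx : x ≠ 0) (y : ℝ) :
    ∫ u, boxKernel u • g (y - x * u) = (1 / (2 * x) : ℂ) * ∫ t in (y - x)..(y + x), g t := by
  rw [integral_boxKernel_smul, intervalIntegral.integral_comp_sub_mul g hx, mul_one, mul_neg_one,
    sub_neg_eq_add, smul_smul, Complex.real_smul]
  push_cast
  congr 1
  field_simp

end UniformAverage

section Cayley

/-- The Cayley transform `w ↦ (1 - w) / (1 + w)`, an involution exchanging the right half plane
and the unit disc; it sends `1` to `0` and the imaginary axis to the unit circle. -/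
noncomputable def cayley (w : ℂ) : ℂ := (1 - w) / (1 + w)

theorem one_add_ne_zero_of_mem_ball {ζ : ℂ} (hζ : ζ ∈ Metric.ball (0 : ℂ) 1) : 1 + ζ ≠ 0 := by
  intro h
  rw [mem_ball_zero_iff, eq_neg_of_add_eq_zero_right h] at hζ
  simp at hζ

theorem one_add_ne_zero_of_re_nonneg {w : ℂ} (hw : 0 ≤ w.re) : 1 + w ≠ 0 := fun h => by
  have := congrArg Complex.re h
  rw [Complex.add_re, Complex.one_re, Complex.zero_re] at this
  linarith

theorem one_add_cayley {w : ℂ} (hw : 1 + w ≠ 0) : 1 + cayley w = 2 / (1 + w) := by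
  rw [cayley]
  field_simp
  ring

theorem cayley_cayley {w : ℂ} (hw : 1 + w ≠ 0) : cayley (cayley w) = w := by
  rw [cayley, one_add_cayley hw, cayley]
  field_simp
  ring

theorem cayley_cayley_mul_cayley {a b : ℂ} (ha : 1 + a ≠ 0) (hb : 1 + b ≠ 0)
    (hab : 1 + a * b ≠ 0) : cayley (cayley a * cayley b) = (a + b) / (1 + a * b) := by
  have hprod : cayley a * cayley b = (1 - a) * (1 - b) / ((1 + a) * (1 + b)) :=
    div_mul_div_comm _ _ _ _
  have hden : 1 + cayley a * cayley b = 2 * (1 + a * b) / ((1 + a) * (1 + b)) := by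
    rw [hprod]
    field_simp
    ring
  have hnum : 1 - cayley a * cayley b = 2 * (a + b) / ((1 + a) * (1 + b)) := by
    rw [hprod]
    field_simp
    ring
  rw [cayley, hden, hnum]
  field_simp

theorem hasDerivAt_cayley {w : ℂ} (hw : 1 + w ≠ 0) : HasDerivAt cayley (-2 / (1 + w) ^ 2) w := by
  have := ((hasDerivAt_id w).const_sub 1).div ((hasDerivAt_id w).const_add 1) hw
  refine this.congr_deriv ?_
  simp only [id_eq]
  ring

theorem cayley_mem_ball {w : ℂ} (hw : w ∈ rightHalfPlane) : cayley w ∈ Metric.ball (0 : ℂ) 1 := by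
  have hre : 0 < w.re := hw
  rw [mem_ball_zero_iff, cayley, norm_div,
    div_lt_one (norm_pos_iff.2 (one_add_ne_zero_of_re_nonneg hre.le)), ← sq_lt_sq₀ (norm_nonneg _)
      (norm_nonneg _), ← Complex.normSq_eq_norm_sq, ← Complex.normSq_eq_norm_sq,
    Complex.normSq_sub, Complex.normSq_add]
  simp only [map_one, one_mul, Complex.conj_re]
  linarith

theorem cayley_mem_rightHalfPlane {ζ : ℂ} (hζ : ζ ∈ Metric.ball (0 : ℂ) 1) :
    cayley ζ ∈ rightHalfPlane := by
  have hsq : Complex.normSq ζ < 1 := by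
    rw [mem_ball_zero_iff] at hζ
    rw [Complex.normSq_eq_norm_sq]
    exact pow_lt_one₀ (norm_nonneg _) hζ two_ne_zero
  have hpos := Complex.normSq_pos.2 (one_add_ne_zero_of_mem_ball hζ)
  have hre : (cayley ζ).re = (1 - Complex.normSq ζ) / Complex.normSq (1 + ζ) := by
    rw [cayley, Complex.div_re, ← add_div]
    congr 1
    simp only [Complex.sub_re, Complex.add_re, Complex.one_re, Complex.sub_im, Complex.add_im,
      Complex.one_im, Complex.normSq_apply]
    ring
  change 0 < (cayley ζ).re
  rw [hre]
  exact div_pos (sub_pos.2 hsq) hpos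

theorem differentiableOn_comp_cayley {f : ℂ → ℂ} (hf : DifferentiableOn ℂ f rightHalfPlane) :
    DifferentiableOn ℂ (fun ζ => f (cayley ζ)) (Metric.ball 0 1) :=
  hf.comp (fun _ hζ => (hasDerivAt_cayley
    (one_add_ne_zero_of_mem_ball hζ)).differentiableAt.differentiableWithinAt)
    fun _ => cayley_mem_rightHalfPlane

theorem exists_primitive {f : ℂ → ℂ} (hf : DifferentiableOn ℂ f rightHalfPlane) :
    ∃ F : ℂ → ℂ, ∀ z ∈ rightHalfPlane, HasDerivAt F (f z) z := by
  have hg : DifferentiableOn ℂ (fun ζ => f (cayley ζ) * (-2 / (1 + ζ) ^ 2)) (Metric.ball 0 1) := by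
    refine (differentiableOn_comp_cayley hf).mul fun ζ hζ => ?_
    have := one_add_ne_zero_of_mem_ball hζ
    fun_prop (disch := positivity)
  obtain ⟨G, hG⟩ := hg.isExactOn_ball
  refine ⟨fun z => G (cayley z), fun z hz => ?_⟩
  have hne := one_add_ne_zero_of_re_nonneg (le_of_lt hz)
  refine ((hG _ (cayley_mem_ball hz)).comp z (hasDerivAt_cayley hne)).congr_deriv ?_
  simp only [cayley_cayley hne, one_add_cayley hne]
  field_simp

theorem exp_two_mul_arctan_mul_I (u : ℝ) :
    Complex.exp ((2 * Real.arctan u : ℝ) * Complex.I) = cayley (-(Complex.I * u)) := by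
  have hne : 1 + -(Complex.I * u) ≠ 0 := one_add_ne_zero_of_re_nonneg (by simp)
  have hcos : (Real.cos (Real.arctan u) : ℂ) ^ 2 * (1 + u ^ 2) = 1 := by
    have h := Real.cos_sq_arctan u
    have := (by positivity : (1 + u ^ 2 : ℝ) ≠ 0)
    rw [eq_div_iff this] at h
    exact_mod_cast h
  have hsin : (Real.sin (Real.arctan u) : ℂ) = Real.cos (Real.arctan u) * u := by
    have := Real.tan_mul_cos (Real.cos_arctan_pos u).ne'
    rw [Real.tan_arctan, mul_comm] at this
    exact_mod_cast this.symm
  have hexp : Complex.exp ((2 * Real.arctan u : ℝ) * Complex.I) =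
      (Real.cos (Real.arctan u) + Real.sin (Real.arctan u) * Complex.I) ^ 2 := by
    rw [Complex.ofReal_cos, Complex.ofReal_sin, ← Complex.exp_mul_I, ← Complex.exp_nat_mul]
    push_cast
    ring_nf
  rw [hexp, hsin, cayley, eq_div_iff hne]
  linear_combination (1 + Complex.I * u) * hcos -
    (Real.cos (Real.arctan u) : ℂ) ^ 2 * u ^ 2 * (1 + u * Complex.I) * Complex.I_sq

end Cayley

section PoissonIntegral

theorem isDensity_cauchyPDFReal (x₀ : ℝ) {γ : NNReal} (hγ : γ ≠ 0) :
    IsDensity (cauchyPDFReal x₀ γ) where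
  integrable := integrable_cauchyPDFReal x₀
  nonneg := ae_of_all _ fun u => (ProbabilityTheory.cauchyPDF_pos x₀ hγ u).le
  integral_eq_one := ProbabilityTheory.integral_cauchyPDFReal_eq_one x₀ hγ

theorem setIntegral_Ioo_neg_pi_pi_eq_integral_two_mul_arctan {E : Type*} [NormedAddCommGroup E]
    [NormedSpace ℝ E] (g : ℝ → E) :
    ∫ θ in Set.Ioo (-Real.pi) Real.pi, g θ =
      ∫ u, (2 / (1 + u ^ 2)) • g (2 * Real.arctan u) := by
  have hrange : (fun u => 2 * Real.arctan u) '' Set.univ = Set.Ioo (-Real.pi) Real.pi := by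
    rw [Set.image_univ, ← Function.comp_def, Set.range_comp, Real.range_arctan,
      Set.image_mul_left_Ioo two_pos]
    congr 1 <;> ring
  have hderiv (u : ℝ) : HasDerivAt (fun u => 2 * Real.arctan u) (2 / (1 + u ^ 2)) u := by
    simpa only [mul_one_div] using (Real.hasDerivAt_arctan u).const_mul 2
  have hinj : Set.InjOn (fun u => 2 * Real.arctan u) Set.univ :=
    ((mul_right_injective₀ two_ne_zero).comp Real.arctan_injective).injOn
  rw [← hrange, integral_image_eq_integral_abs_deriv_smul MeasurableSet.univ
    (fun u _ => (hderiv u).hasDerivWithinAt) hinj, setIntegral_univ]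
  refine integral_congr_ae (ae_of_all _ fun u => ?_)
  simp only [abs_of_pos (by positivity : 0 < 2 / (1 + u ^ 2))]

theorem circleAverage_eq_integral_cauchyPDFReal_smul {E : Type*} [NormedAddCommGroup E]
    [NormedSpace ℝ E] (g : ℂ → E) (r : ℝ) :
    Real.circleAverage g 0 r =
      ∫ u, cauchyPDFReal 0 1 u • g (r * cayley (-(Complex.I * u))) := by
  have hper : Function.Periodic (fun θ => g (circleMap 0 r θ)) (2 * Real.pi) :=
    (periodic_circleMap 0 r).comp g
  have hinterval := hper.intervalIntegral_add_eq 0 (-Real.pi)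
  rw [zero_add, show -Real.pi + 2 * Real.pi = Real.pi by ring,
    intervalIntegral.integral_of_le (neg_le_self Real.pi_nonneg), integral_Ioc_eq_integral_Ioo]
    at hinterval
  rw [Real.circleAverage, hinterval, setIntegral_Ioo_neg_pi_pi_eq_integral_two_mul_arctan,
    ← integral_smul]
  refine integral_congr_ae (ae_of_all _ fun u => ?_)
  simp only [circleMap_zero, exp_two_mul_arctan_mul_I, smul_smul,
    ProbabilityTheory.cauchyPDFReal_def', sub_zero, NNReal.coe_one, inv_one, div_one]
  congr 1
  field_simp

/-- For `0 < s < 1`, the hyperbolic circle about `1` through `s` in the right half plane,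
parametrised by `u : ℝ` so that the point with parameter `u` tends to `-iu` as `s → 0`. -/
noncomputable def hyperbolicCircle (s u : ℝ) : ℂ :=
  (s + -(Complex.I * u)) / (1 + s * -(Complex.I * u))

theorem one_add_mul_neg_I_mul_ne_zero (s u : ℝ) : 1 + (s : ℂ) * -(Complex.I * u) ≠ 0 :=
  one_add_ne_zero_of_re_nonneg (by simp)

theorem cayley_cayley_mul_cayley_neg_I_mul {s : ℝ} (hs : 0 ≤ s) (u : ℝ) :
    cayley (cayley s * cayley (-(Complex.I * u))) = hyperbolicCircle s u :=
  cayley_cayley_mul_cayley (one_add_ne_zero_of_re_nonneg (by simpa))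
    (one_add_ne_zero_of_re_nonneg (by simp)) (one_add_mul_neg_I_mul_ne_zero s u)

theorem hyperbolicCircle_eq (s u : ℝ) :
    hyperbolicCircle s u =
      -(Complex.I * u) + (s * (1 + u ^ 2) / (1 + s ^ 2 * u ^ 2) : ℝ) * (1 + Complex.I * u * s) := by
  have hR : (s * (1 + u ^ 2) / (1 + s ^ 2 * u ^ 2) : ℝ) * (1 + (s : ℂ) ^ 2 * (u : ℂ) ^ 2) =
      s * (1 + (u : ℂ) ^ 2) := by
    exact_mod_cast div_mul_cancel₀ _ (by positivity : 1 + s ^ 2 * u ^ 2 ≠ 0)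
  rw [hyperbolicCircle, div_eq_iff (one_add_mul_neg_I_mul_ne_zero s u)]
  linear_combination -hR - (u ^ 2 * s - (s * (1 + u ^ 2) / (1 + s ^ 2 * u ^ 2) : ℝ) *
    (u : ℂ) ^ 2 * s ^ 2) * Complex.I_sq

theorem hyperbolicCircle_re (s u : ℝ) :
    (hyperbolicCircle s u).re = s * (1 + u ^ 2) / (1 + s ^ 2 * u ^ 2) := by
  rw [hyperbolicCircle_eq, Complex.add_re, Complex.re_ofReal_mul]
  simp

theorem hyperbolicCircle_im (s u : ℝ) :
    (hyperbolicCircle s u).im = -u + u * (s * (hyperbolicCircle s u).re) := by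
  rw [hyperbolicCircle_re, hyperbolicCircle_eq, Complex.add_im, Complex.im_ofReal_mul,
    Complex.neg_im, Complex.add_im]
  simp only [Complex.im_mul_ofReal, Complex.I_im, Complex.one_im]
  ring

theorem hyperbolicCircle_mem_rightHalfPlane {s : ℝ} (hs : 0 < s) (u : ℝ) :
    hyperbolicCircle s u ∈ rightHalfPlane := by
  change 0 < (hyperbolicCircle s u).re
  rw [hyperbolicCircle_re]
  positivity

theorem continuous_hyperbolicCircle :
    Continuous fun p : ℝ × ℝ => hyperbolicCircle p.1 p.2 := by
  unfold hyperbolicCircle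
  exact Continuous.div (by fun_prop) (by fun_prop) fun p =>
    one_add_mul_neg_I_mul_ne_zero p.1 p.2

/-- The mean value property of `f ∘ cayley` on the circle of radius `cayley s`. -/
theorem eq_integral_cauchyPDFReal_smul {f : ℂ → ℂ} (hf : DifferentiableOn ℂ f rightHalfPlane)
    {s : ℝ} (hs : s ∈ Set.Ioo (0 : ℝ) 1) :
    f 1 = ∫ u, cauchyPDFReal 0 1 u • f (hyperbolicCircle s u) := by
  obtain ⟨r, hr, hrs⟩ : ∃ r : ℝ, |r| < 1 ∧ (r : ℂ) = cayley s := by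
    refine ⟨(1 - s) / (1 + s), ?_, by simp [cayley]⟩
    rw [abs_of_pos (div_pos (by linarith [hs.2]) (by linarith [hs.1])),
      div_lt_one (by linarith [hs.1])]
    linarith [hs.1]
  have hmean := ((differentiableOn_comp_cayley hf).diffContOnCl_ball
    (Metric.closedBall_subset_ball hr)).circleAverage
  have hzero : cayley 0 = 1 := by rw [cayley, sub_zero, add_zero, div_one]
  rw [circleAverage_eq_integral_cauchyPDFReal_smul] at hmean
  simpa only [hrs, cayley_cayley_mul_cayley_neg_I_mul hs.1.le, hzero] using hmean.symm

theorem tendsto_hyperbolicCircle_nontangential {x : ℝ} (hx : 0 < x) (y u : ℝ) :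
    Tendsto (fun s : ℝ => x * hyperbolicCircle s u + Complex.I * y) (𝓝[>] 0)
      (nontangential (y - x * u)) := by
  refine Tendsto.mono_right ?_ (le_iSup _ (|u| : ℝ))
  refine tendsto_nhdsWithin_iff.2 ⟨tendsto_nhdsWithin_of_tendsto_nhds ?_, ?_⟩
  · have hcont : Continuous fun s : ℝ => x * hyperbolicCircle s u + Complex.I * y :=
      (continuous_const.mul (continuous_hyperbolicCircle.comp (.prodMk_left u))).add
        continuous_const
    convert hcont.tendsto 0 using 2
    simp only [hyperbolicCircle]
    push_cast
    ring
  · filter_upwards [Ioo_mem_nhdsGT (zero_lt_one' ℝ)] with s hs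
    have hpos : 0 < x * (hyperbolicCircle s u).re :=
      mul_pos hx (hyperbolicCircle_mem_rightHalfPlane hs.1 u)
    have hre : (x * hyperbolicCircle s u + Complex.I * y).re = x * (hyperbolicCircle s u).re := by
      simp
    have him : (x * hyperbolicCircle s u + Complex.I * y).im - (y - x * u) =
        u * (s * (x * (hyperbolicCircle s u).re)) := by
      rw [Complex.add_im, Complex.im_ofReal_mul, hyperbolicCircle_im, Complex.I_mul_im,
        Complex.ofReal_re]
      ring
    refine ⟨hre ▸ hpos, ?_⟩
    rw [him, hre, abs_mul, abs_of_pos (mul_pos hs.1 hpos)]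
    exact mul_le_mul_of_nonneg_left (mul_le_of_le_one_left hpos.le hs.2.le) (abs_nonneg u)

theorem eq_integral_cauchyPDFReal_smul_of_tendsto {f : ℂ → ℂ}
    (hf : DifferentiableOn ℂ f rightHalfPlane) {C : ℝ} (hC : ∀ z ∈ rightHalfPlane, ‖f z‖ ≤ C)
    {b : ℝ → ℂ} (hb : ∀ᵐ t, Tendsto f (nontangential t) (𝓝 (b t))) {x : ℝ} (hx : 0 < x) (y : ℝ) :
    f (x + Complex.I * y) = ∫ u, cauchyPDFReal 0 1 u • b (y - x * u) := by
  let A (w : ℂ) : ℂ := x * w + Complex.I * y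
  have hA : Set.MapsTo A rightHalfPlane rightHalfPlane := fun w hw => by
    have : 0 < w.re := hw
    simpa [A, rightHalfPlane, hx]
  have hfA : DifferentiableOn ℂ (f ∘ A) rightHalfPlane := hf.comp (by fun_prop) hA
  have hb' : ∀ᵐ u, Tendsto f (nontangential (y - x * u)) (𝓝 (b (y - x * u))) :=
    ((Measure.measurePreserving_sub_left volume y).quasiMeasurePreserving.comp
      (Measure.quasiMeasurePreserving_smul volume hx.ne')).ae hb
  have hint := integrable_cauchyPDFReal 0 (γ := 1)
  have hlim : Tendsto
      (fun s => ∫ u, cauchyPDFReal 0 1 u • (f ∘ A) (hyperbolicCircle s u)) (𝓝[>] 0)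
      (𝓝 (∫ u, cauchyPDFReal 0 1 u • b (y - x * u))) := by
    refine tendsto_integral_filter_of_dominated_convergence (fun u => ‖cauchyPDFReal 0 1 u‖ * C)
      ?_ ?_ (hint.norm.mul_const C) ?_
    · filter_upwards [self_mem_nhdsWithin] with s hs
      exact hint.aestronglyMeasurable.smul (hfA.continuousOn.comp_continuous
        (continuous_hyperbolicCircle.comp (.prodMk_right s))
        (hyperbolicCircle_mem_rightHalfPlane hs)).aestronglyMeasurable
    · filter_upwards [self_mem_nhdsWithin] with s hs
      refine ae_of_all _ fun u => ?_
      rw [norm_smul]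
      exact mul_le_mul_of_nonneg_left (hC _ (hA (hyperbolicCircle_mem_rightHalfPlane hs u)))
        (norm_nonneg _)
    · filter_upwards [hb'] with u hu
      exact (hu.comp (tendsto_hyperbolicCircle_nontangential hx y u)).const_smul _
  have hconst : (fun s => ∫ u, cauchyPDFReal 0 1 u • (f ∘ A) (hyperbolicCircle s u)) =ᶠ[𝓝[>] 0]
      fun _ => f (x + Complex.I * y) := by
    filter_upwards [Ioo_mem_nhdsGT (zero_lt_one' ℝ)] with s hs
    rw [← eq_integral_cauchyPDFReal_smul hfA hs, Function.comp_apply]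
    simp only [A, mul_one]
  exact tendsto_nhds_unique (tendsto_const_nhds.congr' hconst.symm) hlim

theorem continuous_integral_smul_comp_im_sub_re_mul {K : ℝ → ℝ} (hK : Integrable K) {h : ℝ → ℂ}
    (hh : Continuous h) {C : ℝ} (hC : ∀ t, ‖h t‖ ≤ C) :
    Continuous fun z : ℂ => ∫ u, K u • h (z.im - z.re * u) := by
  refine continuous_of_dominated (bound := fun u => ‖K u‖ * C) (fun z => ?_)
    (fun z => ae_of_all _ fun u => ?_) (hK.norm.mul_const C) (ae_of_all _ fun u => by fun_prop)
  · have : Continuous fun u => h (z.im - z.re * u) := by fun_prop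
    exact hK.aestronglyMeasurable.smul this.aestronglyMeasurable
  · rw [norm_smul]
    exact mul_le_mul_of_nonneg_left (hC _) (norm_nonneg _)

end PoissonIntegral

section Fatou

theorem isOpen_rightHalfPlane : IsOpen rightHalfPlane :=
  isOpen_lt continuous_const Complex.continuous_re

theorem nontangential_le_nhdsWithin (y : ℝ) :
    nontangential y ≤ 𝓝[rightHalfPlane] (Complex.I * y) :=
  iSup_le fun _ => nhdsWithin_mono _ fun _ hz => hz.1

theorem tendsto_add_I_mul_nontangential (y : ℝ) :
    Tendsto (fun x : ℝ => x + Complex.I * y) (𝓝[>] 0) (nontangential y) := by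
  simpa [hyperbolicCircle] using tendsto_hyperbolicCircle_nontangential one_pos y 0

theorem norm_dslope_le_of_lipschitzWith {𝕜 E : Type*} [NontriviallyNormedField 𝕜]
    [NormedAddCommGroup E] [NormedSpace 𝕜 E] {f : 𝕜 → E} {L : NNReal} (hf : LipschitzWith L f)
    (a b : 𝕜) : ‖dslope f a b‖ ≤ L := by
  obtain rfl | hba := eq_or_ne b a
  · rw [dslope_same]
    exact norm_deriv_le_of_lipschitz hf
  · rw [dslope_of_ne f hba, slope_def_module, norm_smul, norm_inv,
      inv_mul_le_iff₀ (norm_pos_iff.2 (sub_ne_zero.2 hba)), mul_comm]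
    exact hf.norm_sub_le b a

theorem lipschitzWith_comp_I_mul {E : Type*} [PseudoEMetricSpace E] {F : ℂ → E} {L : NNReal}
    (hF : LipschitzWith L F) : LipschitzWith L fun t : ℝ => F (Complex.I * t) := by
  have hI : Isometry fun t : ℝ => Complex.I * t := Isometry.of_dist_eq fun s t => by
    rw [dist_eq_norm, ← mul_sub, norm_mul, Complex.norm_I, one_mul, ← dist_eq_norm]
    exact Complex.isometry_ofReal.dist_eq s t
  simpa only [mul_one, Function.comp_def] using hF.comp hI.lipschitz

theorem dslope_I_mul_eq {F : ℂ → ℂ} {y t : ℝ} (ht : t ≠ y) :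
    dslope F (Complex.I * y) (Complex.I * t) =
      -Complex.I * dslope (fun t : ℝ => F (Complex.I * t)) y t := by
  have hne : Complex.I * (t : ℂ) ≠ Complex.I * y := by
    simpa using ht
  rw [dslope_of_ne _ hne, dslope_of_ne _ ht, slope_def_module, slope_def_module, ← mul_sub,
    smul_eq_mul, Complex.real_smul, mul_inv, Complex.inv_I, ← mul_assoc]
  push_cast
  rfl

/-- The difference quotient of `F` at `iy` is bounded, hence the Poisson integral of its boundary
values. -/
theorem dslope_eq_integral_cauchyPDFReal_smul {F : ℂ → ℂ} {L : NNReal} (hF : LipschitzWith L F)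
    (hFd : DifferentiableOn ℂ F rightHalfPlane) (y : ℝ) {w : ℂ} (hw : w ∈ rightHalfPlane) :
    dslope F (Complex.I * y) w =
      ∫ u, cauchyPDFReal 0 1 u •
        (-Complex.I * dslope (fun t : ℝ => F (Complex.I * t)) y (w.im - w.re * u)) := by
  have hy : Complex.I * (y : ℂ) ∉ rightHalfPlane := by simp [rightHalfPlane]
  have hboundary : ∀ᵐ t : ℝ, Tendsto (dslope F (Complex.I * y)) (nontangential t)
      (𝓝 (-Complex.I * dslope (fun t : ℝ => F (Complex.I * t)) y t)) := by
    filter_upwards [Measure.ae_ne volume y] with t ht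
    rw [← dslope_I_mul_eq ht]
    have hne : Complex.I * (t : ℂ) ≠ Complex.I * y := by simpa using ht
    exact ((continuousAt_dslope_of_ne hne).2 hF.continuous.continuousAt).tendsto.mono_left
      ((nontangential_le_nhdsWithin t).trans nhdsWithin_le_nhds)
  have hpoisson := eq_integral_cauchyPDFReal_smul_of_tendsto
    ((differentiableOn_dslope_of_notMem hy).2 hFd)
    (fun w _ => norm_dslope_le_of_lipschitzWith hF _ w) hboundary hw w.im
  rwa [mul_comm Complex.I (w.im : ℂ), Complex.re_add_im] at hpoisson

theorem hasDerivWithinAt_rightHalfPlane_of_lipschitzWith {F : ℂ → ℂ} {L : NNReal}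
    (hF : LipschitzWith L F) (hFd : DifferentiableOn ℂ F rightHalfPlane) {y : ℝ} {d : ℂ}
    (hd : HasDerivAt (fun t : ℝ => F (Complex.I * t)) d y) :
    HasDerivWithinAt F (-Complex.I * d) rightHalfPlane (Complex.I * y) := by
  have hy : Complex.I * (y : ℂ) ∉ rightHalfPlane := by simp [rightHalfPlane]
  have hL := lipschitzWith_comp_I_mul hF
  let h (t : ℝ) : ℂ := -Complex.I * dslope (fun t : ℝ => F (Complex.I * t)) y t
  have hcont : Continuous h := by
    refine continuous_const.mul (continuousOn_univ.1 ?_)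
    exact (continuousOn_dslope univ_mem).2 ⟨hL.continuous.continuousOn, hd.differentiableAt⟩
  have hbound (t : ℝ) : ‖h t‖ ≤ L := by
    rw [norm_mul, norm_neg, Complex.norm_I, one_mul]
    exact norm_dslope_le_of_lipschitzWith hL y t
  have hlim := (continuous_integral_smul_comp_im_sub_re_mul (integrable_cauchyPDFReal 0 (γ := 1))
    hcont hbound).tendsto (Complex.I * y)
  simp only [Complex.I_mul_re, Complex.I_mul_im, Complex.ofReal_re, Complex.ofReal_im, neg_zero,
    zero_mul, sub_zero, integral_smul_const, h, dslope_same, hd.deriv,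
    (isDensity_cauchyPDFReal 0 one_ne_zero).integral_eq_one, one_smul] at hlim
  rw [hasDerivWithinAt_iff_tendsto_slope' hy]
  refine (hlim.mono_left nhdsWithin_le_nhds).congr' ?_
  filter_upwards [self_mem_nhdsWithin] with w hw
  rw [← dslope_eq_integral_cauchyPDFReal_smul hF hFd y hw,
    dslope_of_ne _ (ne_of_mem_of_not_mem hw hy)]

theorem norm_sub_I_mul_le_of_mem_stolzCone {y M : ℝ} {z : ℂ} (hz : z ∈ stolzCone y M) :
    ‖z - Complex.I * y‖ ≤ (1 + M) * z.re := by
  have := Complex.norm_le_abs_re_add_abs_im (z - Complex.I * y)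
  have hre : (z - Complex.I * y).re = z.re := by simp
  have him : (z - Complex.I * y).im = z.im - y := by simp
  rw [hre, him, abs_of_pos hz.1] at this
  linarith [hz.2]

theorem closedBall_subset_rightHalfPlane {z : ℂ} (hz : z ∈ rightHalfPlane) :
    Metric.closedBall z (z.re / 2) ⊆ rightHalfPlane := fun w hw => by
  have hzre : 0 < z.re := hz
  have := (abs_le.1 ((Complex.abs_re_le_norm (w - z)).trans (mem_closedBall_iff_norm.1 hw))).1
  rw [Complex.sub_re] at this
  change 0 < w.re
  linarith

theorem norm_deriv_le_of_mem_stolzCone {G : ℂ → ℂ} (hG : DifferentiableOn ℂ G rightHalfPlane)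
    {y M η : ℝ} {z : ℂ} (hz : z ∈ stolzCone y M) (hη : 0 ≤ η)
    (hGη : ∀ w ∈ Metric.closedBall z (z.re / 2), ‖G w‖ ≤ η * ‖w - Complex.I * y‖) :
    ‖deriv G z‖ ≤ η * (2 * (2 + M)) := by
  have hr : 0 < z.re / 2 := half_pos hz.1
  have hsphere : ∀ w ∈ Metric.sphere z (z.re / 2), ‖G w‖ ≤ η * ((2 + M) * z.re) := fun w hw => by
    have hw' := Metric.sphere_subset_closedBall hw
    have hdist : ‖w - Complex.I * y‖ ≤ (2 + M) * z.re := calc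
      ‖w - Complex.I * y‖ ≤ ‖w - z‖ + ‖z - Complex.I * y‖ := norm_sub_le_norm_sub_add_norm_sub _ _ _
      _ ≤ z.re / 2 + (1 + M) * z.re :=
        add_le_add (mem_closedBall_iff_norm.1 hw') (norm_sub_I_mul_le_of_mem_stolzCone hz)
      _ ≤ (2 + M) * z.re := by linarith
    exact (hGη w hw').trans (mul_le_mul_of_nonneg_left hdist hη)
  have hcauchy := Complex.norm_deriv_le_of_forall_mem_sphere_norm_le hr
    (hG.diffContOnCl_ball (closedBall_subset_rightHalfPlane hz.1)) hsphere
  refine hcauchy.trans_eq ?_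
  field_simp [hz.1.ne']

theorem tendsto_deriv_nontangential {F : ℂ → ℂ} (hF : DifferentiableOn ℂ F rightHalfPlane)
    {y : ℝ} {c : ℂ} (hc : HasDerivWithinAt F c rightHalfPlane (Complex.I * y)) :
    Tendsto (deriv F) (nontangential y) (𝓝 c) := by
  let G (w : ℂ) : ℂ := F w - F (Complex.I * y) - (w - Complex.I * y) • c
  have hG : DifferentiableOn ℂ G rightHalfPlane := by fun_prop
  have hGderiv {z : ℂ} (hz : z ∈ rightHalfPlane) : deriv G z = deriv F z - c := by
    have hFz := (hF.differentiableAt (isOpen_rightHalfPlane.mem_nhds hz)).hasDerivAt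
    have hGz := (hFz.sub_const (F (Complex.I * y))).sub
      (((hasDerivAt_id z).sub_const (Complex.I * y)).smul_const c)
    rw [one_smul] at hGz
    exact hGz.deriv
  refine tendsto_iSup.2 fun M => Metric.tendsto_nhds.2 fun ε hε => ?_
  set η : ℝ := ε / (2 * (2 + |M|) + 1)
  have hη : 0 < η := by positivity
  obtain ⟨δ, hδ, hGδ⟩ := Metric.mem_nhdsWithin_iff.1
    ((hasDerivWithinAt_iff_isLittleO.1 hc).bound hη)
  filter_upwards [self_mem_nhdsWithin,
    mem_nhdsWithin_of_mem_nhds (Metric.ball_mem_nhds _ (half_pos hδ))] with z hz hzδ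
  have hre : z.re ≤ ‖z - Complex.I * y‖ := by
    simpa using Complex.re_le_norm (z - Complex.I * y)
  have hball : Metric.closedBall z (z.re / 2) ⊆ Metric.ball (Complex.I * y) δ := by
    refine Metric.closedBall_subset_ball' ?_
    rw [dist_eq_norm]
    linarith [mem_ball_iff_norm.1 hzδ]
  have hderiv := norm_deriv_le_of_mem_stolzCone hG hz hη.le fun w hw =>
    hGδ ⟨hball hw, closedBall_subset_rightHalfPlane hz.1 hw⟩
  rw [dist_eq_norm, ← hGderiv hz.1]
  calc ‖deriv G z‖ ≤ η * (2 * (2 + M)) := hderiv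
    _ < η * (2 * (2 + |M|) + 1) := by
      gcongr
      linarith [le_abs_self M]
    _ = ε := div_mul_cancel₀ _ (by positivity)

theorem MemHInfty.exists_lipschitz_primitive {φ : ℂ → ℂ} (hφ : MemHInfty φ) :
    ∃ (F : ℂ → ℂ) (L : NNReal), LipschitzWith L F ∧
      ∀ z ∈ rightHalfPlane, HasDerivAt F (φ z) z := by
  obtain ⟨C, hC⟩ := hφ.bounded
  obtain ⟨F, hF⟩ := exists_primitive hφ.analytic
  have hL : LipschitzOnWith C.toNNReal F rightHalfPlane :=
    (convex_halfSpace_re_gt 0).lipschitzOnWith_of_nnnorm_deriv_le (𝕜 := ℂ)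
      (fun z hz => (hF z hz).differentiableAt) fun z hz => by
        rw [(hF z hz).deriv, ← NNReal.coe_le_coe, coe_nnnorm]
        exact (hC z hz).trans (Real.le_coe_toNNReal C)
  obtain ⟨F', hF', heq⟩ := hL.extend_finite_dimension
  refine ⟨F', _, hF', fun z hz => (hF z hz).congr_of_eventuallyEq ?_⟩
  filter_upwards [isOpen_rightHalfPlane.mem_nhds hz] with w hw
  exact (heq hw).symm

/-- Fatou's theorem. -/
theorem MemHInfty.ae_exists_nontangential_limit {φ : ℂ → ℂ} (hφ : MemHInfty φ) :
    ∀ᵐ y : ℝ, ∃ c, Tendsto φ (nontangential y) (𝓝 c) := by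
  obtain ⟨F, L, hF, hFφ⟩ := hφ.exists_lipschitz_primitive
  have hFd : DifferentiableOn ℂ F rightHalfPlane := fun z hz =>
    (hFφ z hz).differentiableAt.differentiableWithinAt
  filter_upwards [(lipschitzWith_comp_I_mul hF).ae_differentiableAt_real] with y hy
  have hFy := hasDerivWithinAt_rightHalfPlane_of_lipschitzWith hF hFd hy.hasDerivAt
  refine ⟨_, (tendsto_deriv_nontangential hFd hFy).congr' ?_⟩
  filter_upwards [nontangential_le_nhdsWithin y self_mem_nhdsWithin] with z hz
  exact (hFφ z hz).deriv

theorem MemHInfty.ae_tendsto_boundaryFunction {φ : ℂ → ℂ} (hφ : MemHInfty φ) :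
    ∀ᵐ y : ℝ, Tendsto φ (nontangential y) (𝓝 (boundaryFunction φ y)) :=
  hφ.ae_exists_nontangential_limit.mono fun _ => tendsto_nhds_limUnder

theorem MemHInfty.memLp_boundaryFunction {φ : ℂ → ℂ} (hφ : MemHInfty φ) :
    MemLp (boundaryFunction φ) ∞ volume := by
  obtain ⟨C, hC⟩ := hφ.bounded
  obtain ⟨x, -, hxpos, hx⟩ := exists_seq_strictAnti_tendsto (0 : ℝ)
  have hmem (n : ℕ) (y : ℝ) : x n + Complex.I * y ∈ rightHalfPlane := by
    simpa [rightHalfPlane] using hxpos n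
  have hlim : ∀ᵐ y : ℝ, Tendsto (fun n => φ (x n + Complex.I * y)) atTop
      (𝓝 (boundaryFunction φ y)) :=
    hφ.ae_tendsto_boundaryFunction.mono fun y hy =>
      (hy.comp (tendsto_add_I_mul_nontangential y)).comp
        (tendsto_nhdsWithin_iff.2 ⟨hx, .of_forall hxpos⟩)
  have hcont (n : ℕ) : Continuous fun y : ℝ => φ (x n + Complex.I * y) :=
    hφ.analytic.continuousOn.comp_continuous (by fun_prop) (hmem n)
  refine memLp_top_of_bound (aestronglyMeasurable_of_tendsto_ae atTop
    (fun n => (hcont n).aestronglyMeasurable) hlim) C ?_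
  exact hlim.mono fun y hy => le_of_tendsto' hy.norm fun n => hC _ (hmem n y)

theorem MemHInfty.poisson_formula {φ : ℂ → ℂ} (hφ : MemHInfty φ) {x : ℝ} (hx : 0 < x) (y : ℝ) :
    φ (x + Complex.I * y) = ∫ u, cauchyPDFReal 0 1 u • boundaryFunction φ (y - x * u) :=
  let ⟨_, hC⟩ := hφ.bounded
  eq_integral_cauchyPDFReal_smul_of_tendsto hφ.analytic hC hφ.ae_tendsto_boundaryFunction hx y

end Fatou

end AlmostConvergence

theorem theorem4p2 (φ : ℂ → ℂ) (hφ : AlmostConvergence.MemHInfty φ) (α : ℂ) :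
    (∀ᵐ y : ℝ, Tendsto φ (AlmostConvergence.nontangential y)
      (𝓝 (AlmostConvergence.boundaryFunction φ y))) ∧
    ∃ hb : MemLp (AlmostConvergence.boundaryFunction φ) ∞ volume,
      (AlmostConvergence.AlmostConvergent (hb.toLp (AlmostConvergence.boundaryFunction φ)) α ↔
        TendstoUniformly (fun (x y : ℝ) => φ (x + Complex.I * y)) (fun _ => α) atTop) ∧
      (AlmostConvergence.AlmostConvergent (hb.toLp (AlmostConvergence.boundaryFunction φ)) α ↔
        TendstoUniformly
          (fun (θ y : ℝ) => (1 / (2 * θ) : ℂ) *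
            ∫ t in (y - θ)..(y + θ), AlmostConvergence.boundaryFunction φ t)
          (fun _ => α) atTop) := by
  have hb := hφ.memLp_boundaryFunction
  refine ⟨hφ.ae_tendsto_boundaryFunction, hb, ?_, ?_⟩
  · rw [(AlmostConvergence.isDensity_cauchyPDFReal 0 one_ne_zero).almostConvergent_toLp_iff hb]
    refine tendstoUniformly_congr ?_
    filter_upwards [eventually_gt_atTop 0] with x hx
    exact funext fun y => (hφ.poisson_formula hx y).symm
  · rw [AlmostConvergence.isDensity_boxKernel.almostConvergent_toLp_iff hb]
    refine tendstoUniformly_congr ?_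
    filter_upwards [eventually_gt_atTop 0] with θ hθ
    exact funext (AlmostConvergence.integral_boxKernel_smul_comp_sub_mul _ hθ.ne')
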